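/- Let $\Gamma=(V,E,w)$ be a directed network: a directed graph with vertex set $V$ and edge set $E$, either of which may be infinite (loops, multiple edges and directed cycles are allowed), together with a family of independent formal variables $\{w(e)\}_{e\in E}$, the weights of the edges. The weight $w(\pi)$ of a walk $\pi$ is the product of the weights of its edges, with multiplicity; a walk of length $0$ has weight $1$. The walk matrix is $W=(W(a,b))_{a,b\in V}$, where $W(a,b)=\sum_{\pi} w(\pi)$ is the sum over all walks $\pi$ from $a$ to $b$, a formal power series in the edge weights. (Each monomial occurs as the weight of only finitely many walks from $a$ to $b$; infinite sums of power series are taken coefficientwise. Coefficients may be taken in $\mathbb{Z}$ or in any commutative ring.) The loop-erased part $\mathrm{LE}(\pi)$ of a walk $\pi=(a_0\stackrel{e_1}{\to}a_1\to\cdots\stackrel{e_m}{\to}a_m)$ is defined recursively: if all the vertices $a_i$ are distinct, then $\mathrm{LE}(\pi)=\pi$; otherwise $\mathrm{LE}(\pi)=\mathrm{LE}(\pi')$, where $\pi'$ is obtained from $\pi$ by finding $a_i=a_j$, $i<j$, with the smallest value of $j$, and removing the segment $a_i\stackrel{e_{i+1}}{\to}a_{i+1}\to\cdots\stackrel{e_j}{\to}a_j$.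 **Theorem.** Let $A=\{a_1,\dots,a_k\}$ and $B=\{b_1,\dots,b_k\}$ be totally ordered subsets of $V$ of the same cardinality $k$, not necessarily disjoint, and let $W_{A,B}=(W(a_i,b_j))_{i,j=1}^k$. Then, as formal power series in the edge weights, $$\det(W_{A,B})=\sum_{\sigma\in S_k}\mathrm{sgn}(\sigma)\sum_{(\pi_1,\dots,\pi_k)} w(\pi_1)\cdots w(\pi_k),$$ where, for each permutation $\sigma$, the inner sum (which is well defined coefficientwise) runs over all families of walks $\pi_1,\dots,\pi_k$ such that $\pi_i$ goes from $a_i$ to $b_{\sigma(i)}$ for every $i$ and, for all $1\le i<j\le k$, the walk $\pi_j$ has no common vertices with $\mathrm{LE}(\pi_i)$. -/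

import Mathlib

/-! A directed network is a quiver `V` (loops, multiple edges, cycles and infinitely many vertices
and edges are allowed), the edge `e : a ⟶ b` having as its weight its own formal variable.
A walk from `a` to `b` is a `Quiver.Path a b`; it may repeat vertices and edges. -/

open scoped MvPowerSeries.WithPiTopology

namespace Quiver.Path

variable {V : Type*} [Quiver V]

open Classical in
/-- The initial segment of a walk that ends at its first visit to `v`. -/
noncomputable def initialSegment {a : V} (v : V) :
    {b : V} → (p : Path a b) → v ∈ p.vertices → Path a v
  | _, nil, h => nil.cast rfl (by simpa [eq_comm] using h)
  | _, cons p e, h =>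
      if hv : v ∈ p.vertices then initialSegment v p hv
      else (cons p e).cast rfl (by simpa [hv, eq_comm] using h)

open Classical in
/-- Remove from a walk `a₀ → a₁ → ⋯ → aₘ` the first loop it makes: find `aᵢ = aⱼ`, `i < j`, with
the smallest value of `j`, and remove the segment `aᵢ → ⋯ → aⱼ`. A walk without
self-intersections is unchanged.

In the recursion the last vertex `c` of the walk `cons p e` is this `aⱼ` exactly when `p` has no
self-intersections and passes through `c`; otherwise the first loop, if any, lies in `p`. -/
noncomputable def removeFirstLoop {a : V} : {b : V} → Path a b → Path a b
  | _, nil => nil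
  | c, cons p e =>
      if p.vertices.Nodup then
        if hc : c ∈ p.vertices then initialSegment c p hc else cons p e
      else cons (removeFirstLoop p) e

theorem length_initialSegment_le {a : V} (v : V) :
    {b : V} → (p : Path a b) → (h : v ∈ p.vertices) → (initialSegment v p h).length ≤ p.length
  | _, nil, h => by
      obtain rfl : v = a := by simpa using h
      simp [initialSegment]
  | c, cons p e, h => by
      by_cases hv : v ∈ p.vertices
      · have := length_initialSegment_le v p hv
        simp only [initialSegment, hv, dif_pos, length_cons]
        omega
      · obtain rfl : v = c := by simpa [hv] using h
        simp [initialSegment, hv]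

theorem length_removeFirstLoop_lt {a : V} :
    {b : V} → (p : Path a b) → ¬ p.vertices.Nodup → (removeFirstLoop p).length < p.length
  | _, nil, h => by simp at h
  | c, cons p e, h => by
      by_cases hp : p.vertices.Nodup
      · have hc : c ∈ p.vertices := by
          by_contra hc
          apply h
          rw [vertices_cons, List.nodup_concat]
          exact ⟨hc, hp⟩
        have := length_initialSegment_le c p hc
        simp only [removeFirstLoop, hp, hc, if_true, dif_pos, length_cons]
        omega
      · have := length_removeFirstLoop_lt p hp
        simp only [removeFirstLoop, hp, if_false, length_cons]
        omega

open Classical in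
/-- The loop-erased part of a walk: the walk itself if its vertices are distinct, and otherwise
the loop-erased part of the walk obtained by removing the first loop. -/
noncomputable def loopErasure {a b : V} (p : Path a b) : Path a b :=
  if _h : p.vertices.Nodup then p else loopErasure (removeFirstLoop p)
termination_by p.length
decreasing_by exact length_removeFirstLoop_lt p _h

end Quiver.Path

namespace DirectedNetwork

variable {V : Type*} [Quiver V] (R : Type*) [CommRing R]

/-- The formal power series over `R` in the edge weights, one variable for each edge. -/
abbrev EdgeSeries (V : Type*) [Quiver V] (R : Type*) : Type _ := MvPowerSeries (Quiver.Total V) R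

/-- The weight of a walk: the product of the variables of its edges. -/
noncomputable def walkWeight {a b : V} (p : Quiver.Path a b) : EdgeSeries V R :=
  p.weight fun {i j} (e : i ⟶ j) => MvPowerSeries.X (⟨i, j, e⟩ : Quiver.Total V)

/-- The walk matrix: `W(a, b)` is the sum of the weights of all walks from `a` to `b`.
Infinite sums of formal power series are taken coefficientwise, that is, in the product topology
over the discrete ring `R`. -/
noncomputable def walkMatrix (V : Type*) [Quiver V] (R : Type*) [CommRing R] [TopologicalSpace R] :
    Matrix V V (EdgeSeries V R) :=
  Matrix.of fun a b => ∑' p : Quiver.Path a b, walkWeight R p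

/-- The families of walks `πᵢ` from `aᵢ` to `b_{σ(i)}` such that, for all `i < j`, the walk `πⱼ`
has no common vertices with the loop-erased part of `πᵢ`. -/
def LoopErasedFamily {k : ℕ} (a b : Fin k → V) (σ : Equiv.Perm (Fin k)) : Type _ :=
  {π : (i : Fin k) → Quiver.Path (a i) (b (σ i)) //
    ∀ i j, i < j → ∀ v : V, ¬ (v ∈ (π j).vertices ∧ v ∈ (π i).loopErasure.vertices)}

/-- The weight `w(π₁) ⋯ w(πₖ)` of a family of walks. -/
noncomputable def LoopErasedFamily.weight {k : ℕ} {a b : Fin k → V} {σ : Equiv.Perm (Fin k)}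
    (π : LoopErasedFamily a b σ) : EdgeSeries V R :=
  ∏ i, walkWeight R (π.1 i)

end DirectedNetwork

/-!
The determinant is expanded coefficientwise. Each monomial is the weight of finitely many walks
(`finite_edgeCount_eq`), so the coefficient of a monomial in the determinant is the signed number
of all families of walks `πᵢ` from `aᵢ` to `b_{σ(i)}` with this weight
(`coeff_prod_tsum_monomial`), and the claim is that the families violating the condition on
loop-erased parts cancel. They cancel under the following involution.

In such a family, let `i` be the first index such that the loop-erased part of `πᵢ` is met by a
later walk, `v` the first vertex along this loop-erased part that lies on a later walk, and `j` the
smallest index greater than `i` such that `πⱼ` passes through `v` (`Meeting`). Cut `πᵢ` and `πⱼ` at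
their last visits to `v`, and interchange the parts after these visits (`Meeting.swap`). This keeps
the weight and composes `σ` with a transposition.

It is an involution because the new family has its first meeting at the same `i`, `v`, `j`, with
the same cuts (`Meeting.reverse`, `Meeting.swap_unique`). This rests on two facts about
loop erasure. If `v` lies on the loop-erased part of `πᵢ`, and `p` is the part of `πᵢ` up to its
last visit to `v`, then the rest of `πᵢ` avoids the loop-erased part of `p`
(`exists_eq_comp_of_mem_loopErasure`). Conversely, prolonging `p` by any walk that avoids the
loop-erased part of `p` after its starting point keeps that part as an initial piece of the new
loop-erased part (`vertices_loopErasure_prefix_comp`); by the choice of `v`, the tail of `πⱼ` is such a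
walk. Both follow by induction from the description of loop erasure step by step
(`loopErasure_cons`).
-/

/-! ### Loop erasure -/

namespace Quiver.Path

variable {V : Type*} [Quiver V]

theorem vertices_initialSegment_prefix {a : V} (v : V) :
    {b : V} → (p : Path a b) → (h : v ∈ p.vertices) →
      (initialSegment v p h).vertices <+: p.vertices
  | _, nil, h => by
      obtain rfl : v = a := by simpa using h
      simp [initialSegment]
  | c, cons p e, h => by
      by_cases hv : v ∈ p.vertices
      · have := vertices_initialSegment_prefix v p hv
        simp only [initialSegment, hv, dif_pos, vertices_cons, List.concat_eq_append]
        exact this.trans (List.prefix_append _ _)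
      · obtain rfl : v = c := by simpa [hv] using h
        simp [initialSegment, hv]

theorem loopErasure_of_nodup {a b : V} {p : Path a b} (h : p.vertices.Nodup) :
    p.loopErasure = p := by
  rw [loopErasure, dif_pos h]

theorem loopErasure_of_not_nodup {a b : V} {p : Path a b} (h : ¬ p.vertices.Nodup) :
    p.loopErasure = (removeFirstLoop p).loopErasure := by
  rw [loopErasure, dif_neg h]

theorem nodup_vertices_loopErasure {a b : V} (p : Path a b) : p.loopErasure.vertices.Nodup := by
  induction hn : p.length using Nat.strong_induction_on generalizing p with
  | _ n ih =>
    by_cases h : p.vertices.Nodup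
    · rwa [loopErasure_of_nodup h]
    · rw [loopErasure_of_not_nodup h]
      exact ih _ (hn ▸ length_removeFirstLoop_lt p h) _ rfl

theorem not_nodup_vertices_cons {a b c : V} {p : Path a b} (e : b ⟶ c)
    (h : p.vertices.Nodup → c ∈ p.vertices) : ¬ (cons p e).vertices.Nodup := by
  rw [vertices_cons, List.nodup_concat]
  exact fun h' => h'.1 (h h'.2)

open Classical in
/-- Loop erasure can be performed online: after one more step of the walk, either the loop-erased
walk gets longer by that step, or it is cut back to its visit of the new vertex. -/
theorem loopErasure_cons {a b c : V} (p : Path a b) (e : b ⟶ c) :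
    (cons p e).loopErasure =
      if hc : c ∈ p.loopErasure.vertices then initialSegment c p.loopErasure hc
      else cons p.loopErasure e := by
  induction hn : p.length using Nat.strong_induction_on generalizing p with
  | _ n ih =>
    by_cases hp : p.vertices.Nodup
    · by_cases hc : c ∈ p.vertices
      · rw [loopErasure_of_not_nodup (not_nodup_vertices_cons e fun _ => hc)]
        simp only [removeFirstLoop, hp, hc, if_true, dif_pos, loopErasure_of_nodup]
        exact loopErasure_of_nodup ((vertices_initialSegment_prefix c p hc).sublist.nodup hp)
      · have : (cons p e).vertices.Nodup := by
          rw [vertices_cons, List.nodup_concat]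
          exact ⟨hc, hp⟩
        simp only [loopErasure_of_nodup this, loopErasure_of_nodup hp, hc, dif_neg,
          not_false_eq_true]
    · rw [loopErasure_of_not_nodup (not_nodup_vertices_cons e fun h => absurd h hp)]
      simp only [removeFirstLoop, hp, if_false, loopErasure_of_not_nodup hp]
      exact ih _ (hn ▸ length_removeFirstLoop_lt p hp) _ rfl

theorem vertices_loopErasure_cons_of_notMem {a b c : V} {p : Path a b} (e : b ⟶ c)
    (hc : c ∉ p.loopErasure.vertices) :
    (cons p e).loopErasure.vertices = p.loopErasure.vertices ++ [c] := by
  simp [loopErasure_cons, hc]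

theorem vertices_loopErasure_cons_prefix_of_mem {a b c : V} {p : Path a b} (e : b ⟶ c)
    (hc : c ∈ p.loopErasure.vertices) :
    (cons p e).loopErasure.vertices <+: p.loopErasure.vertices := by
  simpa [loopErasure_cons, hc] using vertices_initialSegment_prefix c p.loopErasure hc

theorem mem_tail_vertices_cons {a b c w : V} {q : Path a b} (e : b ⟶ c) :
    w ∈ (cons q e).vertices.tail ↔ w ∈ q.vertices.tail ∨ w = c := by
  rw [vertices_cons, List.concat_eq_append, List.tail_append_of_ne_nil (vertices_ne_nil q)]
  simp

theorem mem_vertices_comp {a b c w : V} {p : Path a b} {q : Path b c} :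
    w ∈ (p.comp q).vertices ↔ w ∈ p.vertices ∨ w ∈ q.vertices.tail := by
  have h := List.cons_head_tail (vertices_ne_nil q)
  rw [vertices_head_eq] at h
  have hp : w ∈ p.vertices ↔ w ∈ p.vertices.dropLast ∨ w = b := by
    rw [← List.mem_singleton, ← List.mem_append, dropLast_append_end_eq]
  rw [vertices_comp, ← h, hp, List.mem_append, List.mem_cons, or_assoc, List.tail_cons]

theorem vertices_eq_append_end {a b : V} (p : Path a b) : ∃ l, p.vertices = l ++ [b] :=
  ⟨_, (dropLast_append_end_eq p).symm⟩

/-- Prolonging a walk by steps that avoid its loop-erased part only prolongs the loop-erased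
part. -/
theorem vertices_loopErasure_prefix_comp {a b c : V} (p : Path a b) (q : Path b c)
    (h : ∀ w ∈ p.loopErasure.vertices, w ∉ q.vertices.tail) :
    p.loopErasure.vertices <+: (p.comp q).loopErasure.vertices := by
  induction q with
  | nil => simp
  | @cons d c q e ih =>
    have hq := ih fun w hw hw' => h w hw ((mem_tail_vertices_cons e).2 (.inl hw'))
    have hcp : c ∉ p.loopErasure.vertices := fun hw =>
      h c hw ((mem_tail_vertices_cons e).2 (.inr rfl))
    rw [comp_cons]
    by_cases hc : c ∈ (p.comp q).loopErasure.vertices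
    · refine (List.prefix_or_prefix_of_prefix hq
        (vertices_loopErasure_cons_prefix_of_mem e hc)).resolve_right fun h' => hcp (h'.subset ?_)
      exact end_mem_vertices _
    · rw [vertices_loopErasure_cons_of_notMem e hc]
      exact hq.trans (List.prefix_append _ _)

theorem _root_.List.IsPrefix.eq_of_mem_of_nodup {α : Type*} {l m : List α} {x : α}
    (h : l <+: m ++ [x]) (hm : (m ++ [x]).Nodup) (hx : x ∈ l) : l = m ++ [x] := by
  rcases List.prefix_concat_iff.1 h with h | h
  · exact h
  · exact absurd (List.mem_singleton_self x)
      (List.disjoint_of_nodup_append hm (h.subset hx))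

/-- A walk can be cut at a vertex of its loop-erased part in such a way that the rest of the walk
avoids the loop-erased part of the initial piece; the cut is at the last visit to that vertex. -/
theorem exists_eq_comp_of_mem_loopErasure {a b v : V} {p : Path a b}
    (hv : v ∈ p.loopErasure.vertices) :
    ∃ (p₁ : Path a v) (p₂ : Path v b), p = p₁.comp p₂ ∧
      ∀ w ∈ p₁.loopErasure.vertices, w ∉ p₂.vertices.tail := by
  induction p with
  | nil =>
    rw [loopErasure_of_nodup (by simp)] at hv
    obtain rfl : v = a := by simpa using hv
    exact ⟨nil, nil, rfl, by simp⟩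
  | @cons d c p e ih =>
    by_cases hvc : v = c
    · subst hvc
      exact ⟨cons p e, nil, rfl, by simp⟩
    have hvp : v ∈ p.loopErasure.vertices := by
      by_cases hc : c ∈ p.loopErasure.vertices
      · exact (vertices_loopErasure_cons_prefix_of_mem e hc).subset hv
      · simpa [vertices_loopErasure_cons_of_notMem e hc, hvc] using hv
    obtain ⟨p₁, p₂, rfl, h⟩ := ih hvp
    refine ⟨p₁, p₂.cons e, rfl, fun w hw hw' => ?_⟩
    rcases (mem_tail_vertices_cons e).1 hw' with hw' | rfl
    · exact h w hw hw'
    -- Otherwise `w`, the end of the walk, precedes `v` on the loop-erased part of `p₁.comp p₂`,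
    -- so the last step cuts off `v`.
    have hpre := vertices_loopErasure_prefix_comp p₁ p₂ h
    have hI := vertices_loopErasure_cons_prefix_of_mem e (hpre.subset hw)
    obtain ⟨l, hl⟩ := vertices_eq_append_end p₁.loopErasure
    obtain ⟨m, hm⟩ := vertices_eq_append_end ((p₁.comp p₂).cons e).loopErasure
    have hln := nodup_vertices_loopErasure p₁
    have hmn := nodup_vertices_loopErasure ((p₁.comp p₂).cons e)
    have heq : l ++ [v] = m ++ [w] := by
      rw [hl] at hln hpre hw
      rw [hm] at hmn hI hv
      rcases List.prefix_or_prefix_of_prefix hpre hI with h' | h'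
      · exact h'.eq_of_mem_of_nodup hmn hw
      · exact (h'.eq_of_mem_of_nodup hln hv).symm
    exact hvc (by simpa using (List.append_inj' heq rfl).2)

/-- The decomposition of a walk at its last visit to a vertex is unique. -/
theorem comp_inj_of_notMem_tail {a b v : V} {p₁ p₂ : Path a v} {q₁ q₂ : Path v b}
    (h : p₁.comp q₁ = p₂.comp q₂) (h₁ : v ∉ q₁.vertices.tail) (h₂ : v ∉ q₂.vertices.tail) :
    p₁ = p₂ ∧ q₁ = q₂ := by
  induction q₁ with
  | nil =>
    cases q₂ with
    | nil => exact ⟨h, rfl⟩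
    | cons q₂ e => exact absurd ((mem_tail_vertices_cons e).2 (.inr rfl)) h₂
  | cons q₁ e₁ ih =>
    cases q₂ with
    | nil => exact absurd ((mem_tail_vertices_cons e₁).2 (.inr rfl)) h₁
    | cons q₂ e₂ =>
      rw [comp_cons, comp_cons] at h
      obtain rfl := obj_eq_of_cons_eq_cons h
      obtain rfl := eq_of_heq (hom_heq_of_cons_eq_cons h)
      obtain ⟨rfl, rfl⟩ := ih (eq_of_heq (heq_of_cons_eq_cons h))
        (fun h' => h₁ ((mem_tail_vertices_cons e₁).2 (.inl h')))
        (fun h' => h₂ ((mem_tail_vertices_cons e₁).2 (.inl h')))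
      exact ⟨rfl, rfl⟩

end Quiver.Path

/-! ### The first meeting and the interchange of tails -/

namespace DirectedNetwork

open Quiver (Path)
open Quiver.Path

variable {V : Type*} [Quiver V] {k : ℕ} {a : Fin k → V}

/-- The first meeting of a family of walks with the loop-erased part of an earlier walk. The walk
`i` is the first one whose loop-erased part is met by a later walk, `v` is the first vertex
along that loop-erased part through which a later walk passes, and `j` is the first later walk
through `v`. The walks `i` and `j` are cut at their last visits to `v`, into `p`, `q` and
`r`, `s` respectively. -/
structure Meeting (F : ∀ i : Fin k, Σ y, Path (a i) y) where
  (i j : Fin k)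
  (v y z : V)
  (p : Path (a i) v)
  (q : Path v y)
  (r : Path (a j) v)
  (s : Path v z)
  lt : i < j
  eq_fst : F i = ⟨y, p.comp q⟩
  eq_snd : F j = ⟨z, r.comp s⟩
  notMem_q : ∀ w ∈ p.loopErasure.vertices, w ∉ q.vertices.tail
  notMem_s : ∀ w ∈ p.loopErasure.vertices, w ∉ s.vertices.tail
  first_v : ∀ l, i < l → ∀ w ∈ p.loopErasure.vertices, w ∈ (F l).2.vertices → w = v
  first_j : ∀ l, i < l → l < j → v ∉ (F l).2.vertices
  first_i : ∀ l < i, ∀ m, l < m → ∀ w ∈ (F l).2.loopErasure.vertices, w ∉ (F m).2.vertices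

namespace Meeting

variable {F : ∀ i : Fin k, Σ y, Path (a i) y}

/-- The family obtained by interchanging the parts of the two meeting walks after the meeting. -/
def swap (M : Meeting F) : ∀ i : Fin k, Σ y, Path (a i) y :=
  Function.update (Function.update F M.i ⟨M.z, M.p.comp M.s⟩) M.j ⟨M.y, M.r.comp M.q⟩

theorem swap_i (M : Meeting F) : M.swap M.i = ⟨M.z, M.p.comp M.s⟩ := by
  simp [swap, M.lt.ne]

theorem swap_j (M : Meeting F) : M.swap M.j = ⟨M.y, M.r.comp M.q⟩ := by
  simp [swap]

theorem swap_of_ne (M : Meeting F) {l : Fin k} (hi : l ≠ M.i) (hj : l ≠ M.j) :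
    M.swap l = F l := by
  simp [swap, hi, hj]

theorem mem_fst_iff (M : Meeting F) {w : V} :
    w ∈ (F M.i).2.vertices ↔ w ∈ M.p.vertices ∨ w ∈ M.q.vertices.tail := by
  rw [M.eq_fst]; exact mem_vertices_comp

theorem mem_snd_iff (M : Meeting F) {w : V} :
    w ∈ (F M.j).2.vertices ↔ w ∈ M.r.vertices ∨ w ∈ M.s.vertices.tail := by
  rw [M.eq_snd]; exact mem_vertices_comp

theorem v_mem_snd (M : Meeting F) : M.v ∈ (F M.j).2.vertices :=
  M.mem_snd_iff.2 (.inl (end_mem_vertices _))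

theorem v_mem_loopErasure_p (M : Meeting F) : M.v ∈ M.p.loopErasure.vertices :=
  end_mem_vertices _

theorem loopErasure_p_prefix (M : Meeting F) :
    M.p.loopErasure.vertices <+: (F M.i).2.loopErasure.vertices := by
  rw [M.eq_fst]; exact vertices_loopErasure_prefix_comp _ _ M.notMem_q

theorem v_mem_loopErasure (M : Meeting F) : M.v ∈ (F M.i).2.loopErasure.vertices :=
  M.loopErasure_p_prefix.subset M.v_mem_loopErasure_p

/-- Interchanging the tails does not affect where the first meeting takes place. -/
def reverse (M : Meeting F) : Meeting M.swap where
  i := M.i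
  j := M.j
  v := M.v
  y := M.z
  z := M.y
  p := M.p
  q := M.s
  r := M.r
  s := M.q
  lt := M.lt
  eq_fst := M.swap_i
  eq_snd := M.swap_j
  notMem_q := M.notMem_s
  notMem_s := M.notMem_q
  first_v l hl w hw hwl := by
    by_cases hj : l = M.j
    · subst hj
      rw [M.swap_j] at hwl
      rcases mem_vertices_comp.1 hwl with h | h
      · exact M.first_v _ hl w hw (M.mem_snd_iff.2 (.inl h))
      · exact absurd h (M.notMem_q w hw)
    · rw [M.swap_of_ne hl.ne' hj] at hwl
      exact M.first_v l hl w hw hwl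
  first_j l hl hlj := by
    rw [M.swap_of_ne hl.ne' hlj.ne]
    exact M.first_j l hl hlj
  first_i l hl m hm w hw hwm := by
    rw [M.swap_of_ne hl.ne (hl.trans M.lt).ne] at hw
    have key : w ∉ (F M.i).2.vertices ∧ w ∉ (F M.j).2.vertices :=
      ⟨M.first_i l hl _ hl w hw, M.first_i l hl _ (hl.trans M.lt) w hw⟩
    rw [mem_fst_iff, mem_snd_iff] at key
    by_cases hi : m = M.i
    · subst hi
      rw [M.swap_i] at hwm
      have := mem_vertices_comp.1 hwm
      tauto
    by_cases hj : m = M.j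
    · subst hj
      rw [M.swap_j] at hwm
      have := mem_vertices_comp.1 hwm
      tauto
    rw [M.swap_of_ne hi hj] at hwm
    exact M.first_i l hl m hm w hw hwm

theorem swap_reverse (M : Meeting F) : M.reverse.swap = F := by
  funext l
  by_cases hi : l = M.i
  · subst hi; exact M.reverse.swap_i.trans M.eq_fst.symm
  by_cases hj : l = M.j
  · subst hj; exact M.reverse.swap_j.trans M.eq_snd.symm
  exact (M.reverse.swap_of_ne hi hj).trans (M.swap_of_ne hi hj)

/-- Two first meetings of the same family involve the same earlier walk. -/
theorem i_le (M N : Meeting F) : M.i ≤ N.i := by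
  by_contra! h
  exact M.first_i _ h _ N.lt _ N.v_mem_loopErasure N.v_mem_snd

/-- The first meeting is determined by the family; only the resulting interchange is recorded. -/
theorem swap_unique (M N : Meeting F) : M.swap = N.swap := by
  have hi : M.i = N.i := le_antisymm (M.i_le N) (N.i_le M)
  have hv : M.v = N.v := by
    have hM := M.loopErasure_p_prefix
    have hN : N.p.loopErasure.vertices <+: (F M.i).2.loopErasure.vertices := by
      rw [hi]; exact N.loopErasure_p_prefix
    rcases List.prefix_or_prefix_of_prefix hM hN with h | h
    · exact N.first_v _ (hi ▸ M.lt) _ (h.subset M.v_mem_loopErasure_p) M.v_mem_snd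
    · exact (M.first_v _ (hi ▸ N.lt) _ (h.subset N.v_mem_loopErasure_p) N.v_mem_snd).symm
  have hj : M.j = N.j := by
    apply le_antisymm
    · by_contra! h
      exact M.first_j _ (hi ▸ N.lt) h (hv ▸ N.v_mem_snd)
    · by_contra! h
      exact N.first_j _ (hi ▸ M.lt) h (hv ▸ M.v_mem_snd)
  obtain ⟨i, j, v, y, z, p, q, r, s, lt, h1, h2, hq, hs, _, _, _⟩ := M
  obtain ⟨i', j', v', y', z', p', q', r', s', lt', h1', h2', hq', hs', _, _, _⟩ := N
  dsimp only at hi hv hj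
  subst hi hv hj
  have e1 := h1.symm.trans h1'
  have e2 := h2.symm.trans h2'
  obtain rfl : y = y' := congrArg Sigma.fst e1
  obtain rfl : z = z' := congrArg Sigma.fst e2
  have hv := end_mem_vertices p.loopErasure
  have hv' := end_mem_vertices p'.loopErasure
  obtain ⟨rfl, rfl⟩ := comp_inj_of_notMem_tail (eq_of_heq (Sigma.mk.inj e1).2)
    (hq _ hv) (hq' _ hv')
  obtain ⟨rfl, rfl⟩ := comp_inj_of_notMem_tail (eq_of_heq (Sigma.mk.inj e2).2)
    (hs _ hv) (hs' _ hv')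
  rfl

/-- A walk of the family meets the loop-erased part of an earlier walk if and only if there is a
first such meeting. -/
theorem nonempty_iff :
    Nonempty (Meeting F) ↔
      ¬ ∀ i j, i < j → ∀ v, ¬ (v ∈ (F j).2.vertices ∧ v ∈ (F i).2.loopErasure.vertices) := by
  classical
  constructor
  · rintro ⟨M⟩ h
    exact h M.i M.j M.lt M.v ⟨M.v_mem_snd, M.v_mem_loopErasure⟩
  intro h
  push Not at h
  obtain ⟨i, ⟨j₀, hj₀, v₀, hvj₀, hv₀⟩, hi⟩ := WellFounded.has_min wellFounded_lt
    {i | ∃ j, i < j ∧ ∃ v, v ∈ (F j).2.vertices ∧ v ∈ (F i).2.loopErasure.vertices} h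
  -- The first vertex of the loop-erased walk `i` that lies on a later walk.
  obtain ⟨v, hv⟩ : ∃ v, (F i).2.loopErasure.vertices.find?
      (fun v => decide (∃ l, i < l ∧ v ∈ (F l).2.vertices)) = some v := by
    rw [← Option.isSome_iff_exists, List.find?_isSome]
    exact ⟨v₀, hv₀, by simpa using ⟨j₀, hj₀, hvj₀⟩⟩
  obtain ⟨hvl, L, L', hL, hfirst⟩ := List.find?_eq_some_iff_append.1 hv
  simp only [decide_eq_true_eq] at hvl
  simp only [Bool.not_eq_true', decide_eq_false_iff_not] at hfirst
  obtain ⟨j, ⟨hij, hvj⟩, hj⟩ := WellFounded.has_min wellFounded_lt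
    {l | i < l ∧ v ∈ (F l).2.vertices} hvl
  have hvi : v ∈ (F i).2.loopErasure.vertices := by rw [hL]; simp
  obtain ⟨p, q, hpq, hq⟩ := exists_eq_comp_of_mem_loopErasure hvi
  obtain ⟨r, s, hrs, hs⟩ := exists_eq_comp_and_notMem_tail_of_mem_vertices _ hvj
  -- The loop-erased part of `p` is the loop-erased walk `i` up to `v`, since `v` occurs there once.
  have hpre : p.loopErasure.vertices = L ++ [v] := by
    have hp := vertices_loopErasure_prefix_comp p q hq
    rw [← hpq] at hp
    obtain ⟨m, hm⟩ := vertices_eq_append_end p.loopErasure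
    obtain ⟨t, ht⟩ := hp
    have hnd := ht ▸ nodup_vertices_loopErasure (F i).2
    rw [hm] at ht hnd ⊢
    rw [hL] at ht
    simp only [List.append_assoc, List.singleton_append] at ht hnd
    have h1 : v ∉ m := fun hvm => (List.disjoint_of_nodup_append hnd) hvm (by simp)
    have h1' : v ∉ t := fun hvm =>
      (List.nodup_cons.1 (List.nodup_append.1 hnd).2.1).1 hvm
    rw [((List.append_cons_inj_of_notMem h1 h1').1 ht).1]
  have hfv : ∀ l, i < l → ∀ w ∈ p.loopErasure.vertices, w ∈ (F l).2.vertices → w = v := by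
    intro l hl w hw hwl
    rw [hpre, List.mem_append, List.mem_singleton] at hw
    exact hw.resolve_left fun hw => hfirst w hw ⟨l, hl, hwl⟩
  exact ⟨{
    i := i, j := j, v := v, y := _, z := _, p := p, q := q, r := r, s := s
    lt := hij
    eq_fst := Sigma.ext rfl (heq_of_eq hpq)
    eq_snd := Sigma.ext rfl (heq_of_eq hrs)
    notMem_q := hq
    notMem_s := fun w hw hws => hs <|
      hfv j hij w hw (by rw [hrs]; exact mem_vertices_comp.2 (.inr hws)) ▸ hws
    first_v := hfv
    first_j := fun l hl hlj hvl => hj l ⟨hl, hvl⟩ hlj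
    first_i := fun l hl m hm w hw hwm => hi l ⟨m, hm, w, hwm, hw⟩ hl }⟩

end Meeting

end DirectedNetwork

/-! ### Generating series -/

namespace DirectedNetwork

open Quiver (Path)
open Quiver.Path

section Series

variable {T R : Type*} [CommRing R]

/-- The generating series of a statistic `e` on a type `ι`: the coefficient of the monomial with
exponent `n` is the number of `i : ι` with `e i = n`. It is meant for `e` with finite fibres; an
infinite fibre is counted as `0`. -/
noncomputable def generatingSeries (R : Type*) [CommRing R] {ι : Type*} (e : ι → T →₀ ℕ) :
    MvPowerSeries T R :=
  fun n => (({i | e i = n}.ncard : ℕ) : R)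

theorem coeff_generatingSeries {ι : Type*} (e : ι → T →₀ ℕ) (n : T →₀ ℕ) :
    MvPowerSeries.coeff n (generatingSeries R e) = (({i | e i = n}.ncard : ℕ) : R) :=
  rfl

variable [TopologicalSpace R]

theorem hasSum_monomial {ι : Type*} {e : ι → T →₀ ℕ} (he : ∀ n, {i | e i = n}.Finite) :
    HasSum (fun i => MvPowerSeries.monomial (e i) (1 : R))
      (generatingSeries R e) := by
  classical
  rw [MvPowerSeries.WithPiTopology.hasSum_iff_hasSum_coeff]
  intro n
  have h := hasSum_sum_of_ne_finset_zero (L := .unconditional ι) (s := (he n).toFinset)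
    (f := fun i => MvPowerSeries.coeff n (MvPowerSeries.monomial (e i) (1 : R))) (by
      intro i hi
      rw [MvPowerSeries.coeff_monomial, if_neg]
      simpa [eq_comm] using hi)
  convert h using 1
  rw [Finset.sum_congr rfl (g := fun _ => (1 : R)), Finset.sum_const, nsmul_one,
    coeff_generatingSeries, Set.ncard_eq_toFinset_card _ (he n)]
  · intro i hi
    rw [MvPowerSeries.coeff_monomial, if_pos]
    simpa [eq_comm] using hi

theorem coeff_tsum_monomial [T2Space R] {ι : Type*} {e : ι → T →₀ ℕ}
    (he : ∀ n, {i | e i = n}.Finite) (n : T →₀ ℕ) :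
    MvPowerSeries.coeff n (∑' i, MvPowerSeries.monomial (e i) (1 : R)) =
      (({i | e i = n}.ncard : ℕ) : R) := by
  rw [(hasSum_monomial he).tsum_eq, coeff_generatingSeries]

theorem finite_sum_eq {κ : Type*} [Fintype κ] {ι : κ → Type*} {e : ∀ j, ι j → T →₀ ℕ}
    (he : ∀ j n, {i | e j i = n}.Finite) (n : T →₀ ℕ) :
    {x : ∀ j, ι j | ∑ j, e j (x j) = n}.Finite := by
  have hle : ∀ j, {i | e j i ≤ n}.Finite := fun j => by
    classical
    refine ((Set.finite_Iic n).biUnion fun m _ => he j m).subset fun i hi => ?_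
    simpa using hi
  refine (Set.Finite.pi' hle).subset fun x hx j => ?_
  rw [Set.mem_ofPred_eq] at hx ⊢
  rw [← hx]
  exact Finset.single_le_sum (f := fun j => e j (x j)) (fun _ _ => zero_le) (Finset.mem_univ j)

/-- A finite product of generating series counts families by the sum of their statistics. -/
theorem coeff_prod_tsum_monomial [T2Space R] {κ : Type*} [Fintype κ] {ι : κ → Type*}
    {e : ∀ j, ι j → T →₀ ℕ} (he : ∀ j n, {i | e j i = n}.Finite) (n : T →₀ ℕ) :
    MvPowerSeries.coeff n (∏ j, ∑' i, MvPowerSeries.monomial (e j i) (1 : R)) =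
      (({x : ∀ j, ι j | ∑ j, e j (x j) = n}.ncard : ℕ) : R) := by
  classical
  rw [MvPowerSeries.coeff_prod, Set.ncard_eq_toFinset_card _ (finite_sum_eq he n),
    Finset.card_eq_sum_card_fiberwise (t := Finset.univ.finsuppAntidiag n)
      (f := fun x => Finsupp.equivFunOnFinite.symm fun j => e j (x j)), Nat.cast_sum]
  · refine Finset.sum_congr rfl fun l hl => ?_
    rw [Finset.mem_finsuppAntidiag] at hl
    have : {x ∈ (finite_sum_eq he n).toFinset |
        (Finsupp.equivFunOnFinite.symm fun j => e j (x j)) = l} =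
          Fintype.piFinset fun j => (he j (l j)).toFinset := by
      ext x
      simp only [Finset.mem_filter, Set.Finite.mem_toFinset, Set.mem_ofPred_eq,
        Fintype.mem_piFinset, Equiv.symm_apply_eq]
      constructor
      · rintro ⟨-, h⟩ j
        exact congrFun h j
      · intro h
        refine ⟨?_, funext h⟩
        rw [← hl.1]
        exact Finset.sum_congr rfl fun j _ => h j
    rw [this, Fintype.card_piFinset, Nat.cast_prod]
    refine Finset.prod_congr rfl fun j _ => ?_
    rw [coeff_tsum_monomial (he j), Set.ncard_eq_toFinset_card _ (he j (l j))]
  · intro x hx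
    simp only [Finset.mem_coe, Set.Finite.mem_toFinset, Set.mem_ofPred_eq] at hx
    simp [Finset.mem_finsuppAntidiag, hx]

end Series

/-! ### Weights of walks -/

variable {V : Type*} [Quiver V]

/-- The exponent of the weight of a walk: how often the walk uses each edge. -/
noncomputable def edgeCount {x y : V} (p : Path x y) : Quiver.Total V →₀ ℕ :=
  p.addWeight fun {i j} (e : i ⟶ j) => Finsupp.single (⟨i, j, e⟩ : Quiver.Total V) 1

@[simp]
theorem edgeCount_cons {x y z : V} (p : Path x y) (e : y ⟶ z) :
    edgeCount (p.cons e) = edgeCount p + Finsupp.single (⟨y, z, e⟩ : Quiver.Total V) 1 :=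
  addWeight_cons _ _ _

theorem edgeCount_comp {x y z : V} (p : Path x y) (q : Path y z) :
    edgeCount (p.comp q) = edgeCount p + edgeCount q :=
  addWeight_comp _ _ _

theorem walkWeight_eq_monomial (R : Type*) [CommRing R] {x y : V} (p : Path x y) :
    walkWeight R p = MvPowerSeries.monomial (edgeCount p) (1 : R) := by
  induction p with
  | nil => simp [walkWeight, edgeCount, MvPowerSeries.monomial_zero_one]
  | cons p e ih =>
    rw [edgeCount_cons, ← one_mul (1 : R), ← MvPowerSeries.monomial_mul_monomial, ← ih]
    exact weight_cons _ _ _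

/-- Only finitely many walks from `x` use each edge a prescribed number of times: the last edge is
one of the finitely many edges in the support of `n`, and without it the walk has a smaller
exponent. -/
theorem finite_edgeCount_eq (x : V) (n : Quiver.Total V →₀ ℕ) :
    {q : Σ y, Path x y | edgeCount q.2 = n}.Finite := by
  classical
  induction hm : n.degree using Nat.strong_induction_on generalizing n with
  | _ m ih =>
    -- `extend e q` is the walk `q` followed by `e`; the value `q` is irrelevant where `e` does not
    -- start at the end of `q`.
    let extend (e : Quiver.Total V) (q : Σ y, Path x y) : Σ y, Path x y :=
      if h : q.1 = e.left then ⟨e.right, (h ▸ q.2 : Path x e.left).cons e.hom⟩ else q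
    have hfin : ∀ e ∈ n.support,
        {q : Σ y, Path x y | edgeCount q.2 = n - Finsupp.single e 1}.Finite := by
      intro e he
      refine ih _ ?_ _ rfl
      have hle : Finsupp.single e 1 ≤ n := by
        rw [Finsupp.single_le_iff]
        exact Nat.one_le_iff_ne_zero.2 (Finsupp.mem_support_iff.1 he)
      have := congrArg Finsupp.degree (tsub_add_cancel_of_le hle)
      rw [map_add, Finsupp.degree_single] at this
      omega
    refine ((Set.finite_singleton ⟨x, Path.nil⟩).union
      (n.support.finite_toSet.biUnion fun e he => (hfin e he).image (extend e))).subset ?_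
    rintro ⟨z, q⟩ hq
    rw [Set.mem_ofPred_eq] at hq
    cases q with
    | nil => exact .inl rfl
    | @cons y _ q e =>
      rw [edgeCount_cons] at hq
      refine .inr (Set.mem_biUnion (x := (⟨y, z, e⟩ : Quiver.Total V)) ?_ ⟨⟨y, q⟩, ?_, ?_⟩)
      · simp [← hq]
      · simp [← hq]
      · simp [extend]

theorem finite_walk_edgeCount_eq (x y : V) (n : Quiver.Total V →₀ ℕ) :
    {p : Path x y | edgeCount p = n}.Finite :=
  (finite_edgeCount_eq x n).preimage (f := Sigma.mk y) sigma_mk_injective.injOn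

/-! ### Families of walks with prescribed endpoints -/

variable {k : ℕ} {a b : Fin k → V}

theorem LoopErasedFamily.weight_eq_monomial (R : Type*) [CommRing R] {σ : Equiv.Perm (Fin k)}
    (π : LoopErasedFamily a b σ) :
    π.weight R = MvPowerSeries.monomial (∑ i, edgeCount (π.1 i)) (1 : R) := by
  simp only [weight, walkWeight_eq_monomial]
  induction (Finset.univ : Finset (Fin k)) using Finset.cons_induction with
  | empty => simp [MvPowerSeries.monomial_zero_one]
  | cons i s hi ih =>
    rw [Finset.prod_cons, Finset.sum_cons, ih, MvPowerSeries.monomial_mul_monomial, one_mul]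

theorem finite_family_eq (σ : Equiv.Perm (Fin k)) (n : Quiver.Total V →₀ ℕ) :
    {π : ∀ i, Path (a i) (b (σ i)) | ∑ i, edgeCount (π i) = n}.Finite :=
  finite_sum_eq (fun _ => finite_walk_edgeCount_eq _ _) n

theorem finite_loopErasedFamily_eq (σ : Equiv.Perm (Fin k)) (n : Quiver.Total V →₀ ℕ) :
    {π : LoopErasedFamily a b σ | ∑ i, edgeCount (π.1 i) = n}.Finite :=
  (finite_family_eq σ n).preimage (f := Subtype.val) Subtype.val_injective.injOn

/-- A family of walks from the `aᵢ` to the `b_{σ(i)}`, with the endpoints recorded as part of the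
data rather than in the type. This allows comparing families for different `σ`. -/
def toSigma (x : Σ σ : Equiv.Perm (Fin k), ∀ i, Path (a i) (b (σ i))) (i : Fin k) :
    Σ y, Path (a i) y :=
  ⟨b (x.1 i), x.2 i⟩

theorem toSigma_injective (hb : Function.Injective b) :
    Function.Injective (toSigma (a := a) (b := b)) := by
  rintro ⟨σ, π⟩ ⟨τ, ρ⟩ h
  obtain rfl : σ = τ := Equiv.ext fun i => hb (congrArg Sigma.fst (congrFun h i))
  congr 1
  funext i
  exact eq_of_heq (Sigma.mk.inj (congrFun h i)).2

theorem exists_toSigma_eq {F : ∀ i, Σ y, Path (a i) y} {σ : Equiv.Perm (Fin k)}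
    (h : ∀ i, (F i).1 = b (σ i)) : ∃ π, toSigma (b := b) ⟨σ, π⟩ = F := by
  have : ∀ i, ∃ p : Path (a i) (b (σ i)), (⟨b (σ i), p⟩ : Σ y, Path (a i) y) = F i := fun i => by
    rw [← h i]; exact ⟨(F i).2, rfl⟩
  choose π hπ using this
  exact ⟨π, funext hπ⟩

/-- Interchanging the tails of walks `i` and `j` also interchanges their endpoints, so it composes
the permutation with a transposition. -/
theorem Meeting.exists_toSigma_eq_swap
    {x : Σ σ : Equiv.Perm (Fin k), ∀ i, Path (a i) (b (σ i))} (M : Meeting (toSigma x)) :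
    ∃ π, toSigma (b := b) ⟨x.1 * Equiv.swap M.i M.j, π⟩ = M.swap := by
  refine exists_toSigma_eq fun l => ?_
  by_cases hi : l = M.i
  · subst hi
    rw [M.swap_i, Equiv.Perm.mul_apply, Equiv.swap_apply_left]
    exact (congrArg Sigma.fst M.eq_snd).symm
  by_cases hj : l = M.j
  · subst hj
    rw [M.swap_j, Equiv.Perm.mul_apply, Equiv.swap_apply_right]
    exact (congrArg Sigma.fst M.eq_fst).symm
  rw [M.swap_of_ne hi hj, Equiv.Perm.mul_apply, Equiv.swap_apply_of_ne_of_ne hi hj]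
  rfl

theorem Meeting.sum_edgeCount_swap {F : ∀ i : Fin k, Σ y, Path (a i) y} (M : Meeting F) :
    ∑ i, edgeCount (M.swap i).2 = ∑ i, edgeCount (F i).2 := by
  have hji : M.j ∈ Finset.univ.erase M.i := by simp [M.lt.ne']
  rw [← Finset.add_sum_erase _ _ (Finset.mem_univ M.i), ← Finset.add_sum_erase _ _ hji,
    ← Finset.add_sum_erase _ (fun i => edgeCount (F i).2) (Finset.mem_univ M.i),
    ← Finset.add_sum_erase _ _ hji, M.swap_i, M.swap_j, M.eq_fst, M.eq_snd,
    Finset.sum_congr rfl fun l hl => ?_, edgeCount_comp, edgeCount_comp, edgeCount_comp,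
    edgeCount_comp]
  · abel
  · simp only [Finset.mem_erase] at hl
    rw [M.swap_of_ne hl.2.1 hl.1]

/-! ### Cancellation -/

/-- The families with a meeting cancel in pairs: the interchange of tails at the first meeting is
an involution that keeps the weight and changes the sign. -/
theorem sum_sign_meeting_eq_zero (R : Type*) [CommRing R] (hb : Function.Injective b)
    (s : Finset (Σ σ : Equiv.Perm (Fin k), ∀ i, Path (a i) (b (σ i))))
    (n : Quiver.Total V →₀ ℕ)
    (hs : ∀ x, x ∈ s ↔ ∑ i, edgeCount (x.2 i) = n ∧ Nonempty (Meeting (toSigma x))) :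
    ∑ x ∈ s, ((Equiv.Perm.sign x.1 : ℤ) : R) = 0 := by
  have hM : ∀ x ∈ s, ∃ x', ∃ M : Meeting (toSigma x), toSigma x' = M.swap ∧
      x'.1 = x.1 * Equiv.swap M.i M.j := fun x hx => by
    obtain ⟨M⟩ := ((hs x).1 hx).2
    obtain ⟨π, hπ⟩ := M.exists_toSigma_eq_swap
    exact ⟨⟨_, π⟩, M, hπ, rfl⟩
  choose g M hg hsign using hM
  have hmem : ∀ x hx, g x hx ∈ s := fun x hx => by
    refine (hs _).2 ⟨?_, ?_⟩
    · have := (M x hx).sum_edgeCount_swap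
      rw [← hg] at this
      exact this.trans ((hs x).1 hx).1
    · rw [hg]; exact ⟨(M x hx).reverse⟩
  have hneg : ∀ x hx, (Equiv.Perm.sign (g x hx).1 : ℤ) = -(Equiv.Perm.sign x.1 : ℤ) :=
    fun x hx => by
      rw [hsign, Equiv.Perm.sign_mul, Equiv.Perm.sign_swap (M x hx).lt.ne]
      simp
  refine Finset.sum_involution g (fun x hx => ?_) (fun x hx _ h => ?_) hmem fun x hx => ?_
  · rw [hneg]; simp
  · have := hneg x hx
    rw [h] at this
    have h0 := Equiv.Perm.sign x.1 |>.ne_zero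
    omega
  · apply toSigma_injective hb
    rw [hg]
    -- Stated for general families so that the equality `F = N'.swap` can be substituted.
    have key : ∀ {F F' : ∀ i : Fin k, Σ y, Path (a i) y} (N : Meeting F) (N' : Meeting F'),
        F = N'.swap → N.swap = F' := by
      rintro _ F' N N' rfl
      rw [N.swap_unique N'.reverse, N'.swap_reverse]
    exact key _ (M x hx) (hg x hx)

/-- A family of walks is either a loop-erased family or has a first meeting. -/
theorem ncard_loopErasedFamily_add (σ : Equiv.Perm (Fin k)) (n : Quiver.Total V →₀ ℕ) :
    {π : LoopErasedFamily a b σ | ∑ i, edgeCount (π.1 i) = n}.ncard +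
      {π : ∀ i, Path (a i) (b (σ i)) | ∑ i, edgeCount (π i) = n ∧
        Nonempty (Meeting (toSigma ⟨σ, π⟩))}.ncard =
    {π : ∀ i, Path (a i) (b (σ i)) | ∑ i, edgeCount (π i) = n}.ncard := by
  have h := Set.ncard_sdiff_add_ncard_of_subset
    (s := {π : ∀ i, Path (a i) (b (σ i)) | ∑ i, edgeCount (π i) = n ∧
        Nonempty (Meeting (toSigma ⟨σ, π⟩))})
    (t := {π | ∑ i, edgeCount (π i) = n}) (fun π hπ => hπ.1) (finite_family_eq σ n)
  rw [← h]
  congr 1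
  refine (Set.ncard_image_of_injective (f := fun π : LoopErasedFamily a b σ => π.1) _
    Subtype.val_injective).symm.trans (congrArg Set.ncard ?_)
  ext π
  simp only [Set.mem_image, Set.mem_ofPred_eq, Set.mem_sdiff, Meeting.nonempty_iff, not_and, not_not]
  constructor
  · rintro ⟨ρ, hρ, rfl⟩
    exact ⟨hρ, fun _ i j hij v hv hv' => ρ.2 i j hij v ⟨hv, hv'⟩⟩
  · rintro ⟨hn, hπ⟩
    exact ⟨⟨π, fun i j hij v h => hπ hn i j hij v h.1 h.2⟩, hn, rfl⟩

end DirectedNetwork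

/-- Minors of the walk matrix of a directed network. The first two parts say that the infinite
sums that define the walk matrix and those on the right-hand side of the formula exist. -/
theorem mainTheorem1 {V : Type*} [Quiver V]
    {R : Type*} [CommRing R] [TopologicalSpace R] [DiscreteTopology R]
    {k : ℕ} (a b : Fin k ↪ V) :
    (∀ x y : V, Summable fun p : Quiver.Path x y => DirectedNetwork.walkWeight R p) ∧
    (∀ σ : Equiv.Perm (Fin k),
      Summable fun π : DirectedNetwork.LoopErasedFamily a b σ => π.weight R) ∧
    ((DirectedNetwork.walkMatrix V R).submatrix a b).det =
      ∑ σ : Equiv.Perm (Fin k), Equiv.Perm.sign σ •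
        ∑' π : DirectedNetwork.LoopErasedFamily a b σ, π.weight R := by
  open DirectedNetwork in
  simp only [walkMatrix, walkWeight_eq_monomial, LoopErasedFamily.weight_eq_monomial]
  refine ⟨fun x y => (hasSum_monomial (finite_walk_edgeCount_eq x y)).summable,
    fun σ => (hasSum_monomial (finite_loopErasedFamily_eq σ)).summable, ?_⟩
  -- Transposing makes the terms of the determinant products of the `W (a i) (b (σ i))`.
  rw [← Matrix.det_transpose, Matrix.det_apply]
  ext n
  simp only [Matrix.transpose_apply, Matrix.submatrix_apply, Matrix.of_apply, Units.smul_def,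
    map_sum, map_zsmul]
  rw [← sub_eq_zero, ← Finset.sum_sub_distrib]
  have hfin : ∀ σ : Equiv.Perm (Fin k), {π : ∀ i, Quiver.Path (a i) (b (σ i)) |
      ∑ i, edgeCount (π i) = n ∧ Nonempty (Meeting (toSigma ⟨σ, π⟩))}.Finite := fun σ =>
    (finite_family_eq σ n).subset fun π hπ => hπ.1
  -- The difference of the two sides counts the families with a meeting.
  rw [← sum_sign_meeting_eq_zero R b.injective
    (Finset.univ.sigma fun σ => (hfin σ).toFinset) n (fun x => by simp), Finset.sum_sigma]
  refine Finset.sum_congr rfl fun σ _ => ?_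
  rw [coeff_prod_tsum_monomial fun i => finite_walk_edgeCount_eq (a i) (b (σ i)),
    coeff_tsum_monomial (finite_loopErasedFamily_eq σ), ← ncard_loopErasedFamily_add,
    Finset.sum_congr rfl (g := fun _ => ((Equiv.Perm.sign σ : ℤ) : R)) fun _ _ => rfl,
    Finset.sum_const, ← Set.ncard_eq_toFinset_card _ (hfin σ)]
  simp only [zsmul_eq_mul, nsmul_eq_mul]
  push_cast
  ring
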